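/- Let $A$ be a unital $*$-algebra over $\mathbb C$ with a $*$-filtration $\{A_n\}_{n\ge 0}$ by finite-dimensional subspaces: $A_m\subseteq A_n$ for $m<n$, $A=\bigcup_n A_n$, $A_n^*=A_n$, $A_mA_n\subseteq A_{m+n}$, and $A_0=\mathbb C 1_A$. Let $\sigma$ be a faithful state on $A$, that is, a linear functional with $\sigma(1_A)=1$ and $\sigma(a^*a)>0$ for all $a\ne 0$. Let $\mathcal H=L^2(A,\sigma)$ be the corresponding GNS Hilbert space (the completion of $A$ for the inner product $\langle a,b\rangle=\sigma(a^*b)$), with norm $\|\cdot\|_2$. Assume that for each $a\in A$ left multiplication by $a$ is bounded on $(A,\|\cdot\|_2)$, so that $A$ is identified with an algebra of bounded operators on $\mathcal H$, and let $\|\cdot\|$ denote the operator norm. Let $Q_n$ be the orthogonal projection of $\mathcal H$ onto $A_n$, let $P_0=Q_0$ and $P_n=Q_n-Q_{n-1}$ for $n\ge 1$, and for $a\in A$ let $a_k=P_k(a)\in A_k$, where $a$ is viewed as a vector. Let $D=\sum_{n} nP_n$, an unbounded operator on $\mathcal H$ whose domain is the set of $\xi$ for which $\sum_n nP_n\xi$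 converges unconditionally (equivalently, $\sum_n n^2\|P_n\xi\|_2^2<\infty$). For $a\in A$ let $L(a)=\|[D,a]\|$, the operator norm of $[D,a]$ on its natural domain $\{\xi\in\operatorname{dom}D: a\xi\in\operatorname{dom}D\}$. Suppose that there is a constant $C$ such that $$\|P_m\,a_k\,P_n\|\le C\,\|a_k\|_2\qquad\text{for all } a\in A \text{ and all integers } m,n,k\ge 0,$$ where on the left $a_k$ is viewed as an operator. Then $L$ is a Lip-norm. That is, $L$ is a finite-valued seminorm on $A$ with $L(a)=0$ exactly when $a\in\mathbb C1_A$, and, on the state space $S(A)$ of the pre-$C^*$-algebra $(A,\|\cdot\|)$ (the positive linear functionals on $A$ of norm $1$ for $\|\cdot\|$), the topology determined by $$\rho_L(\mu,\nu)=\sup\{|\mu(a)-\nu(a)| : a\in A,\ L(a)\le 1\}$$ coincides with the weak-$*$ topology. -/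

import Mathlib

open scoped ComplexOrder ENNReal InnerProductSpace

/-- A `*`-filtration of the unital `*`-algebra `A` by finite-dimensional subspaces. -/
structure StarFiltration (A : Type*) [Ring A] [StarRing A] [Algebra ℂ A] [StarModule ℂ A] where
  /-- The subspaces `A_n`. -/
  space : ℕ → Submodule ℂ A
  finiteDimensional : ∀ n, FiniteDimensional ℂ (space n)
  mono : Monotone space
  exists_mem : ∀ a : A, ∃ n, a ∈ space n
  star_mem : ∀ n, ∀ a ∈ space n, star a ∈ space n
  mul_mem : ∀ m n, ∀ a ∈ space m, ∀ b ∈ space n, a * b ∈ space (m + n)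
  space_zero : space 0 = Submodule.span ℂ {1}

/-- A faithful state on the unital `*`-algebra `A`: a unital linear functional with
`σ (a* a) > 0` for all `a ≠ 0`. -/
structure FaithfulState (A : Type*) [Ring A] [StarRing A] [Algebra ℂ A] [StarModule ℂ A] where
  /-- The underlying linear functional. -/
  toFun : A →ₗ[ℂ] ℂ
  pos : ∀ a : A, a ≠ 0 → 0 < toFun (star a * a)
  map_one : toFun 1 = 1

section Operators

variable {H : Type*} [NormedAddCommGroup H] [NormedSpace ℂ H]

/-- The commutator `[D, T] = D T - T D` of an unbounded operator `D` with a bounded operator `T`,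
on its natural domain `{ξ ∈ dom D | T ξ ∈ dom D}`. -/
def unboundedCommutator (D : H →ₗ.[ℂ] H) (T : H →L[ℂ] H) : H →ₗ.[ℂ] H where
  domain := D.domain ⊓ D.domain.comap T.toLinearMap
  toFun :=
    { toFun := fun ξ => D ⟨T ξ, ξ.2.2⟩ - T (D ⟨ξ, ξ.2.1⟩)
      map_add' := fun ξ η => by
        have h1 : (⟨T ((ξ + η : _) : H), (ξ + η).2.2⟩ : D.domain)
            = ⟨T ξ, ξ.2.2⟩ + ⟨T η, η.2.2⟩ := Subtype.ext (by simp)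
        have h2 : (⟨((ξ + η : _) : H), (ξ + η).2.1⟩ : D.domain)
            = ⟨ξ, ξ.2.1⟩ + ⟨η, η.2.1⟩ := Subtype.ext (by simp)
        rw [h1, h2, LinearPMap.map_add, LinearPMap.map_add, _root_.map_add]
        abel
      map_smul' := fun c ξ => by
        have h1 : (⟨T ((c • ξ : _) : H), (c • ξ).2.2⟩ : D.domain)
            = c • ⟨T ξ, ξ.2.2⟩ := Subtype.ext (by simp)
        have h2 : (⟨((c • ξ : _) : H), (c • ξ).2.1⟩ : D.domain)
            = c • ⟨ξ, ξ.2.1⟩ := Subtype.ext (by simp)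
        rw [h1, h2, LinearPMap.map_smul, LinearPMap.map_smul, _root_.map_smul]
        simp [smul_sub] }

/-- The operator norm, in `[0, ∞]`, of a partially defined operator: the supremum of `‖S ξ‖` over
the vectors `ξ` of norm at most one in the domain. -/
noncomputable def unboundedOpNorm (S : H →ₗ.[ℂ] H) : ℝ≥0∞ :=
  ⨆ (ξ : S.domain) (_ : ‖(ξ : H)‖ ≤ 1), ‖S ξ‖ₑ

end Operators

namespace FaithfulState

variable {A : Type*} [Ring A] [StarRing A] [Algebra ℂ A] [StarModule ℂ A] (σ : FaithfulState A)

theorem nonneg (a : A) : 0 ≤ σ.toFun (star a * a) := by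
  by_cases h : a = 0
  · simp [h]
  · exact (σ.pos a h).le

/-- Positivity implies that the sesquilinear form `σ (a* b)` is hermitian. -/
theorem conj_symm (a b : A) :
    (starRingEnd ℂ) (σ.toFun (star b * a)) = σ.toFun (star a * b) := by
  have im0 : ∀ c : A, (σ.toFun (star c * c)).im = 0 := fun c =>
    ((Complex.le_def.1 (σ.nonneg c)).2).symm
  have h1 := im0 (a + b)
  have h2 := im0 (a + Complex.I • b)
  have ha := im0 a
  have hb := im0 b
  simp only [star_add, star_smul, add_mul, mul_add, smul_mul_assoc, mul_smul_comm, map_add,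
    map_smul, Complex.add_im, smul_eq_mul, Complex.star_def, Complex.conj_I, Complex.mul_im,
    Complex.mul_re, Complex.neg_re, Complex.neg_im, Complex.I_re, Complex.I_im] at h1 h2
  apply Complex.ext
  · rw [Complex.conj_re]; linarith
  · rw [Complex.conj_im]; linarith

set_option linter.unusedVariables false in
/-- A copy of `A`, to carry the inner product `⟪a, b⟫ = σ (a* b)`. -/
@[nolint unusedArguments]
def PreL2 (σ : FaithfulState A) : Type _ := A

instance : AddCommGroup σ.PreL2 := inferInstanceAs (AddCommGroup A)
instance : Module ℂ σ.PreL2 := inferInstanceAs (Module ℂ A)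

/-- The identity map from `A` to its copy. -/
def toPreL2 : A ≃ₗ[ℂ] σ.PreL2 := LinearEquiv.refl ℂ A

/-- The inner product `⟪a, b⟫ = σ (a* b)`. -/
noncomputable abbrev preL2Core : InnerProductSpace.Core ℂ σ.PreL2 where
  inner a b := σ.toFun (star (σ.toPreL2.symm a) * σ.toPreL2.symm b)
  conj_inner_symm a b := σ.conj_symm _ _
  re_inner_nonneg a := (Complex.le_def.1 (σ.nonneg (σ.toPreL2.symm a))).1
  add_left a b c := by simp only [map_add, star_add, add_mul]
  smul_left a b r := by simp
  definite a h := by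
    by_contra h0
    exact (σ.pos (σ.toPreL2.symm a) (by simpa using h0)).ne' h

noncomputable instance : NormedAddCommGroup σ.PreL2 :=
  InnerProductSpace.Core.toNormedAddCommGroup (cd := σ.preL2Core)
noncomputable instance : InnerProductSpace ℂ σ.PreL2 :=
  InnerProductSpace.ofCore σ.preL2Core.toCore

/-- The GNS Hilbert space `L²(A, σ)`. -/
abbrev L2 : Type _ := UniformSpace.Completion σ.PreL2

/-- An element of `A`, viewed as a vector of `L²(A, σ)`. -/
noncomputable def vec : A →ₗ[ℂ] σ.L2 :=
  (UniformSpace.Completion.toComplL : σ.PreL2 →L[ℂ] σ.L2).toLinearMap ∘ₗ σ.toPreL2.toLinearMap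

theorem inner_vec (a b : A) : ⟪σ.vec a, σ.vec b⟫_ℂ = σ.toFun (star a * b) :=
  UniformSpace.Completion.inner_coe (𝕜 := ℂ) (σ.toPreL2 a) (σ.toPreL2 b)

theorem vec_injective : Function.Injective σ.vec := fun _ _ h =>
  σ.toPreL2.injective (UniformSpace.Completion.coe_injective σ.PreL2 h)

/-- The left regular representation of `A` on `L²(A, σ)` is by bounded operators. -/
def LeftRegularBounded : Prop :=
  ∀ a : A, ∃ K : ℝ, ∀ b : A, ‖σ.vec (a * b)‖ ≤ K * ‖σ.vec b‖

variable {σ}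

/-- Left multiplication by `a` on the dense subspace `A` of `L²(A, σ)`. -/
noncomputable def preLeftRep (hσ : σ.LeftRegularBounded) (a : A) : σ.PreL2 →L[ℂ] σ.PreL2 :=
  (σ.toPreL2.toLinearMap ∘ₗ LinearMap.mulLeft ℂ a ∘ₗ
    σ.toPreL2.symm.toLinearMap).mkContinuousOfExistsBound (by
      obtain ⟨K, hK⟩ := hσ a
      refine ⟨K, fun x => ?_⟩
      have h := hK (σ.toPreL2.symm x)
      simpa [vec] using h)

/-- The element `a` of `A`, viewed as a bounded operator on `L²(A, σ)` through the left regular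
representation. -/
noncomputable def leftRep (hσ : σ.LeftRegularBounded) (a : A) : σ.L2 →L[ℂ] σ.L2 :=
  (preLeftRep hσ a).completion

theorem leftRep_vec (hσ : σ.LeftRegularBounded) (a b : A) :
    leftRep hσ a (σ.vec b) = σ.vec (a * b) := by
  exact ContinuousLinearMap.completion_apply_coe (preLeftRep hσ a) (σ.toPreL2 b)

end FaithfulState

namespace StarFiltration

variable {A : Type*} [Ring A] [StarRing A] [Algebra ℂ A] [StarModule ℂ A]
  (F : StarFiltration A) (σ : FaithfulState A)

/-- The subspace `A_n`, viewed inside `L²(A, σ)`. -/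
noncomputable def vecSpace (n : ℕ) : Submodule ℂ σ.L2 := (F.space n).map σ.vec

instance (n : ℕ) : FiniteDimensional ℂ (F.vecSpace σ n) :=
  have := F.finiteDimensional n
  inferInstanceAs (FiniteDimensional ℂ ((F.space n).map σ.vec))

/-- The orthogonal projection `Q_n` of `L²(A, σ)` onto `A_n`. -/
noncomputable def projQ (n : ℕ) : σ.L2 →L[ℂ] σ.L2 := (F.vecSpace σ n).starProjection

/-- `P_0 = Q_0`, and `P_n = Q_n - Q_{n-1}` for `n ≥ 1`. -/
noncomputable def projP : ℕ → (σ.L2 →L[ℂ] σ.L2)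
  | 0 => F.projQ σ 0
  | n + 1 => F.projQ σ (n + 1) - F.projQ σ n

theorem exists_component (k : ℕ) (a : A) : ∃ b : A, σ.vec b = F.projP σ k (σ.vec a) := by
  have hQ : ∀ n, ∃ b : A, σ.vec b = F.projQ σ n (σ.vec a) := fun n => by
    obtain ⟨b, -, hb⟩ := Submodule.starProjection_apply_mem (F.vecSpace σ n) (σ.vec a)
    exact ⟨b, hb⟩
  cases k with
  | zero => exact hQ 0
  | succ n =>
    obtain ⟨b, hb⟩ := hQ (n + 1)
    obtain ⟨c, hc⟩ := hQ n
    exact ⟨b - c, by simp [projP, hb, hc]⟩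

/-- The component `a_k = P_k a`, as an element of `A`. -/
noncomputable def component (k : ℕ) (a : A) : A := (F.exists_component σ k a).choose

theorem vec_component (k : ℕ) (a : A) :
    σ.vec (F.component σ k a) = F.projP σ k (σ.vec a) :=
  (F.exists_component σ k a).choose_spec

/-- The unbounded operator `D = ∑ n P_n` on `L²(A, σ)`. Its domain consists of the vectors `ξ` for
which `∑ n P_n ξ` converges; the terms being orthogonal, this says `∑ n² ‖P_n ξ‖² < ∞`. -/
noncomputable def dirac : σ.L2 →ₗ.[ℂ] σ.L2 where
  domain :=
    { carrier := {ξ | Summable fun n : ℕ => (n : ℂ) • F.projP σ n ξ}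
      zero_mem' := by simp
      add_mem' := fun {ξ η} hξ hη => by
        have h := Summable.add hξ hη
        simpa [smul_add] using h
      smul_mem' := fun c ξ hξ => by
        have h := Summable.const_smul c hξ
        simpa [smul_comm c] using h }
  toFun :=
    { toFun := fun ξ => ∑' n : ℕ, (n : ℂ) • F.projP σ n (ξ : σ.L2)
      map_add' := fun ξ η => by
        rw [← Summable.tsum_add ξ.2 η.2]
        simp [smul_add]
      map_smul' := fun c ξ => by
        rw [RingHom.id_apply, ← Summable.tsum_const_smul c ξ.2]
        simp [smul_comm c] }

variable {σ}

/-- `L a = ‖[D, a]‖`, with values in `[0, ∞]`. -/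
noncomputable def lip (hσ : σ.LeftRegularBounded) (a : A) : ℝ≥0∞ :=
  unboundedOpNorm (unboundedCommutator (F.dirac σ) (FaithfulState.leftRep hσ a))

/-- The Haagerup-type condition: `‖P_m a_k P_n‖ ≤ C ‖a_k‖₂` for some constant `C`. -/
def HaagerupType (hσ : σ.LeftRegularBounded) : Prop :=
  ∃ C : ℝ, ∀ (a : A) (m n k : ℕ),
    ‖F.projP σ m ∘L FaithfulState.leftRep hσ (F.component σ k a) ∘L F.projP σ n‖
      ≤ C * ‖σ.vec (F.component σ k a)‖

end StarFiltration

section LipNorm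

variable {A : Type*} [Ring A] [StarRing A] [Algebra ℂ A] [StarModule ℂ A]

/-- The state space of the unital pre-C*-algebra `A` with C*-norm `N`: the positive linear
functionals on `A` of norm one with respect to `N`. -/
structure StateSpace (N : A → ℝ) where
  /-- The underlying linear functional. -/
  toFun : A →ₗ[ℂ] ℂ
  nonneg : ∀ a : A, 0 ≤ toFun (star a * a)
  map_one : toFun 1 = 1
  norm_le : ∀ a : A, ‖toFun a‖ ≤ N a

/-- The weak-* topology on the state space: pointwise convergence on `A`. -/
@[reducible]
noncomputable def StateSpace.weakStar (N : A → ℝ) : TopologicalSpace (StateSpace N) :=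
  TopologicalSpace.induced (fun (μ : StateSpace N) (a : A) => μ.toFun a) Pi.topologicalSpace

/-- The distance `ρ_L(μ, ν) = sup {|μ a - ν a| : L a ≤ 1}` in `[0, ∞]`. -/
noncomputable def StateSpace.dist {N : A → ℝ} (L : A → ℝ≥0∞) (μ ν : StateSpace N) : ℝ≥0∞ :=
  ⨆ (a : A) (_ : L a ≤ 1), ‖μ.toFun a - ν.toFun a‖ₑ

/-- The state space with the distance `ρ_L`. -/
@[reducible]
noncomputable def StateSpace.lipMetric (N : A → ℝ) (L : A → ℝ≥0∞) :
    PseudoEMetricSpace (StateSpace N) where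
  edist := StateSpace.dist L
  edist_self μ := by simp [StateSpace.dist]
  edist_comm μ ν := by simp only [StateSpace.dist, ← edist_eq_enorm_sub, edist_comm]
  edist_triangle μ ν τ := by
    refine iSup₂_le fun a ha => ?_
    have h1 : ‖μ.toFun a - ν.toFun a‖ₑ ≤ StateSpace.dist L μ ν :=
      le_iSup₂ (f := fun (a : A) (_ : L a ≤ 1) => ‖μ.toFun a - ν.toFun a‖ₑ) a ha
    have h2 : ‖ν.toFun a - τ.toFun a‖ₑ ≤ StateSpace.dist L ν τ :=
      le_iSup₂ (f := fun (a : A) (_ : L a ≤ 1) => ‖ν.toFun a - τ.toFun a‖ₑ) a ha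
    refine le_trans ?_ (add_le_add h1 h2)
    rw [← edist_eq_enorm_sub, ← edist_eq_enorm_sub, ← edist_eq_enorm_sub]
    exact edist_triangle _ _ _

/-- A Lip-norm on the unital pre-C*-algebra `A` with C*-norm `N`: a (finite) seminorm that vanishes
exactly on the scalars and is such that the topology of `ρ_L` on the state space is the weak-*
topology. -/
structure IsLipNorm (N : A → ℝ) (L : A → ℝ≥0∞) : Prop where
  ne_top : ∀ a : A, L a ≠ ∞
  add_le : ∀ a b : A, L (a + b) ≤ L a + L b
  smul_eq : ∀ (c : ℂ) (a : A), L (c • a) = ‖c‖ₑ * L a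
  eq_zero_iff : ∀ a : A, L a = 0 ↔ ∃ c : ℂ, a = c • 1
  topology_eq :
    (StateSpace.lipMetric N L).toUniformSpace.toTopologicalSpace = StateSpace.weakStar N

end LipNorm

/-!
The point is that the unit ball of `L` is totally bounded for the operator norm modulo the scalars;
then a finite net of that ball shows that the distance between states is controlled by finitely
many evaluations, so the weak-* topology is finer than that of `ρ_L`. The converse inclusion of
topologies only needs `L` to be finite.

View an element `a` as the matrix with entries `P_m a P_n`. The entries of `[D, a]` are
`(m - n) P_m a P_n`. For `a ∈ A_k` the matrix is supported in the band `|m - n| ≤ k`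
(`projP_leftRep_projP_eq_zero`), so `[D, a]` is bounded and `L` is finite; this band structure also
shows that `a` preserves the domain of `D`, which makes `L` subadditive.

For total boundedness, two estimates are combined.

* Off a band `|m - n| ≤ N`, the matrix of `a` is that of `[D, a]` with entries multiplied by
  `1 / (m - n)`. The rows of this multiplier have `ℓ²`-norm of order `N ^ (-1/2)`, and a multiplier
  with rows bounded in `ℓ²` is bounded with the same constant (`sum_sq_schur_le`). So this part of
  `a` has norm of order `N ^ (-1/2) L a` (`sum_sq_off_band_le`).
* In the band the norm is at most `2 N + 1` times a bound for the entries (`sum_sq_band_le`), and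
  by the Haagerup-type condition the entries are bounded by `C ∑ ‖a_k‖₂` (`norm_entry_le`).
  Applying `[D, a]` to the vector `1` gives `∑ k² ‖a_k‖₂² ≤ L(a)²`, so the tail `k > K` of
  this sum is of order `K ^ (-1/2) L a` (`sum_norm_projP_le`).

Choosing `N` first and then `K`, the operator norm on a ball for `L` is small as soon as the
projection of `a` to the finite-dimensional space `A_K` is small (`exists_norm_leftRep_le`), and
these projections range over a bounded set once `σ a = 0` (`norm_projQ_vec_le`).
-/

open Filter Topology

/-! ### The spectral projections of the filtration -/

namespace StarFiltration

variable {A : Type*} [Ring A] [StarRing A] [Algebra ℂ A] [StarModule ℂ A]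
  (F : StarFiltration A) (σ : FaithfulState A)

theorem vecSpace_mono : Monotone (F.vecSpace σ) := fun _ _ h => Submodule.map_mono (F.mono h)

theorem vec_mem_vecSpace {n : ℕ} {a : A} (ha : a ∈ F.space n) : σ.vec a ∈ F.vecSpace σ n :=
  Submodule.mem_map_of_mem ha

theorem projQ_eq_self {n : ℕ} {x : σ.L2} (hx : x ∈ F.vecSpace σ n) : F.projQ σ n x = x :=
  Submodule.starProjection_eq_self_iff.2 hx

theorem projQ_mem (n : ℕ) (x : σ.L2) : F.projQ σ n x ∈ F.vecSpace σ n :=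
  Submodule.starProjection_apply_mem _ _

theorem projQ_projQ (m n : ℕ) (x : σ.L2) :
    F.projQ σ m (F.projQ σ n x) = F.projQ σ (min m n) x := by
  rcases le_total m n with h | h
  · rw [min_eq_left h]
    exact congrArg (fun T : σ.L2 →L[ℂ] σ.L2 => T x)
      (Submodule.starProjection_comp_starProjection_of_le (F.vecSpace_mono σ h))
  · rw [min_eq_right h]
    exact F.projQ_eq_self σ (F.vecSpace_mono σ h (F.projQ_mem σ n x))

theorem inner_projQ (n : ℕ) (x y : σ.L2) : ⟪F.projQ σ n x, y⟫_ℂ = ⟪x, F.projQ σ n y⟫_ℂ :=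
  Submodule.inner_starProjection_left_eq_right _ x y

theorem inner_projP (n : ℕ) (x y : σ.L2) : ⟪F.projP σ n x, y⟫_ℂ = ⟪x, F.projP σ n y⟫_ℂ := by
  cases n <;> simp [projP, inner_projQ, inner_sub_left, inner_sub_right]

theorem projP_mem (n : ℕ) (x : σ.L2) : F.projP σ n x ∈ F.vecSpace σ n := by
  cases n with
  | zero => exact F.projQ_mem σ 0 x
  | succ n =>
    exact sub_mem (F.projQ_mem σ _ x) (F.vecSpace_mono σ n.le_succ (F.projQ_mem σ _ x))

theorem projP_projQ (m n : ℕ) (x : σ.L2) :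
    F.projP σ m (F.projQ σ n x) = if m ≤ n then F.projP σ m x else 0 := by
  cases m with
  | zero => simp [projP, projQ_projQ]
  | succ m =>
    simp only [projP, _root_.sub_apply, projQ_projQ]
    split_ifs with h
    · rw [min_eq_left h, min_eq_left (by lia)]
    · rw [min_eq_right (by lia), min_eq_right (by lia), sub_self]

theorem projP_eq_zero {m n : ℕ} (h : n < m) {x : σ.L2} (hx : x ∈ F.vecSpace σ n) :
    F.projP σ m x = 0 := by
  rw [← F.projQ_eq_self σ hx, projP_projQ, if_neg (by lia)]

theorem projP_projP (m n : ℕ) (x : σ.L2) :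
    F.projP σ m (F.projP σ n x) = if m = n then F.projP σ n x else 0 := by
  cases n with
  | zero =>
    change F.projP σ m (F.projQ σ 0 x) = if m = 0 then F.projQ σ 0 x else 0
    rw [projP_projQ]
    cases m <;> simp [projP]
  | succ n =>
    conv_lhs => rw [projP.eq_2, _root_.sub_apply, map_sub, projP_projQ, projP_projQ]
    rcases lt_trichotomy m (n + 1) with h | h | h
    · rw [if_pos (by lia), if_pos (by lia), if_neg (by lia), sub_self]
    · rw [if_pos (by lia), if_neg (by lia), if_pos h, sub_zero, h]
    · rw [if_neg (by lia), if_neg (by lia), if_neg (by lia), sub_self]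

theorem sum_projP (n : ℕ) (x : σ.L2) :
    ∑ k ∈ Finset.range (n + 1), F.projP σ k x = F.projQ σ n x := by
  induction n with
  | zero => simp [projP]
  | succ n ih => rw [Finset.sum_range_succ, ih]; simp [projP]

theorem orthogonalFamily_projP :
    OrthogonalFamily ℂ (fun n => (F.projP σ n).range) fun n => (F.projP σ n).range.subtypeₗᵢ := by
  rintro m n h ⟨_, x, rfl⟩ ⟨_, y, rfl⟩
  change ⟪F.projP σ m x, F.projP σ n y⟫_ℂ = 0
  rw [inner_projP, projP_projP, if_neg h, inner_zero_right]

theorem norm_sq_sum_projP (s : Finset ℕ) (x : ℕ → σ.L2) :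
    ‖∑ n ∈ s, F.projP σ n (x n)‖ ^ 2 = ∑ n ∈ s, ‖F.projP σ n (x n)‖ ^ 2 :=
  (F.orthogonalFamily_projP σ).norm_sum (fun n => ⟨_, x n, rfl⟩) s

theorem summable_projP_iff (x : ℕ → σ.L2) :
    (Summable fun n => F.projP σ n (x n)) ↔ Summable fun n => ‖F.projP σ n (x n)‖ ^ 2 :=
  (F.orthogonalFamily_projP σ).summable_iff_norm_sq_summable (fun n => ⟨_, x n, rfl⟩)

theorem norm_sq_projQ (n : ℕ) (x : σ.L2) :
    ‖F.projQ σ n x‖ ^ 2 = ∑ k ∈ Finset.range (n + 1), ‖F.projP σ k x‖ ^ 2 := by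
  rw [← sum_projP, norm_sq_sum_projP]

theorem sum_norm_sq_projP_le (s : Finset ℕ) (x : σ.L2) :
    ∑ k ∈ s, ‖F.projP σ k x‖ ^ 2 ≤ ‖x‖ ^ 2 := by
  obtain ⟨n, hn⟩ := s.exists_nat_subset_range
  calc ∑ k ∈ s, ‖F.projP σ k x‖ ^ 2 ≤ ∑ k ∈ Finset.range (n + 1), ‖F.projP σ k x‖ ^ 2 :=
        Finset.sum_le_sum_of_subset_of_nonneg
          (hn.trans (Finset.range_subset_range.2 n.le_succ)) fun _ _ _ => by positivity
    _ = ‖F.projQ σ n x‖ ^ 2 := (F.norm_sq_projQ σ n x).symm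
    _ ≤ ‖x‖ ^ 2 := by
        gcongr
        exact Submodule.norm_starProjection_apply_le _ _

theorem norm_projP_le (n : ℕ) (x : σ.L2) : ‖F.projP σ n x‖ ≤ ‖x‖ := by
  have := F.sum_norm_sq_projP_le σ {n} x
  rw [Finset.sum_singleton] at this
  exact le_of_sq_le_sq this (norm_nonneg _)

theorem denseRange_vec : DenseRange σ.vec :=
  (UniformSpace.Completion.denseRange_coe (α := σ.PreL2)).comp
    σ.toPreL2.surjective.denseRange (UniformSpace.Completion.continuous_coe _)

theorem tendsto_projQ (x : σ.L2) : Tendsto (fun n => F.projQ σ n x) atTop (𝓝 x) := by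
  refine Submodule.starProjection_tendsto_self _ (F.vecSpace_mono σ) x fun y _ => ?_
  refine closure_mono ?_ (denseRange_vec σ y)
  rintro _ ⟨a, rfl⟩
  obtain ⟨n, hn⟩ := F.exists_mem a
  exact Submodule.mem_iSup_of_mem n (F.vec_mem_vecSpace σ hn)

theorem norm_sq_le_of_sum_le {x : σ.L2} {R : ℝ}
    (h : ∀ n, ∑ k ∈ Finset.range (n + 1), ‖F.projP σ k x‖ ^ 2 ≤ R) : ‖x‖ ^ 2 ≤ R :=
  le_of_tendsto' ((F.tendsto_projQ σ x).norm.pow 2) fun n => (F.norm_sq_projQ σ n x).trans_le (h n)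

theorem ext_projP {x y : σ.L2} (h : ∀ n, F.projP σ n x = F.projP σ n y) : x = y :=
  tendsto_nhds_unique (F.tendsto_projQ σ x) <| (F.tendsto_projQ σ y).congr fun n => by
    rw [← sum_projP, ← sum_projP, Finset.sum_congr rfl fun k _ => h k]

/-- The elementary estimate for Schur multipliers: if the rows of the scalar matrix `φ` are
square-summable with sum of squares at most `R`, then multiplying the entries `P_m x_n` by
`φ m n` and summing over `n` gives a vector of squared norm at most `R ∑ ‖x_n‖²`. It follows from
the Cauchy-Schwarz inequality in each row and from Bessel's inequality for each `x_n`. -/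
theorem sum_sq_schur_le {φ : ℕ → ℕ → ℝ} {R : ℝ} (s t : Finset ℕ)
    (hφ : ∀ m, ∑ n ∈ s, φ m n ^ 2 ≤ R) (x : ℕ → σ.L2) :
    ∑ m ∈ t, (∑ n ∈ s, φ m n * ‖F.projP σ m (x n)‖) ^ 2 ≤ R * ∑ n ∈ s, ‖x n‖ ^ 2 := by
  have hR : 0 ≤ R := (Finset.sum_nonneg fun n _ => sq_nonneg (φ 0 n)).trans (hφ 0)
  calc ∑ m ∈ t, (∑ n ∈ s, φ m n * ‖F.projP σ m (x n)‖) ^ 2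
      ≤ ∑ m ∈ t, R * ∑ n ∈ s, ‖F.projP σ m (x n)‖ ^ 2 := by
        refine Finset.sum_le_sum fun m _ => (Finset.sum_mul_sq_le_sq_mul_sq _ _ _).trans ?_
        gcongr
        exact hφ m
    _ = R * ∑ n ∈ s, ∑ m ∈ t, ‖F.projP σ m (x n)‖ ^ 2 := by
        rw [← Finset.mul_sum, Finset.sum_comm]
    _ ≤ R * ∑ n ∈ s, ‖x n‖ ^ 2 := by
        gcongr
        exact F.sum_norm_sq_projP_le σ t _

end StarFiltration

/-! ### Norms of partially defined operators -/

section UnboundedOpNorm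

variable {H : Type*} [NormedAddCommGroup H] [NormedSpace ℂ H]

theorem norm_apply_le_unboundedOpNorm (S : H →ₗ.[ℂ] H) (hS : unboundedOpNorm S ≠ ∞)
    (ξ : S.domain) : ‖S ξ‖ ≤ (unboundedOpNorm S).toReal * ‖(ξ : H)‖ := by
  have key : ∀ η : S.domain, ‖(η : H)‖ ≤ 1 → ‖S η‖ ≤ (unboundedOpNorm S).toReal := fun η hη => by
    have h : ‖S η‖ₑ ≤ unboundedOpNorm S :=
      le_iSup₂ (f := fun (η : S.domain) (_ : ‖(η : H)‖ ≤ 1) => ‖S η‖ₑ) η hη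
    simpa using ENNReal.toReal_mono hS h
  rcases eq_or_ne (ξ : H) 0 with h0 | h0
  · have : ξ = 0 := Subtype.ext h0
    simp [this]
  · have hpos : 0 < ‖(ξ : H)‖ := norm_pos_iff.2 h0
    have h := key (((‖(ξ : H)‖⁻¹ : ℝ) : ℂ) • ξ) (by
      rw [Submodule.coe_smul, norm_smul]
      simp [hpos.ne'])
    rw [LinearPMap.map_smul, norm_smul] at h
    simp only [Complex.norm_real, norm_inv, norm_norm] at h
    rwa [inv_mul_le_iff₀ hpos, mul_comm] at h

theorem unboundedOpNorm_le (S : H →ₗ.[ℂ] H) {R : ℝ} (hR : 0 ≤ R)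
    (h : ∀ ξ : S.domain, ‖S ξ‖ ≤ R * ‖(ξ : H)‖) : unboundedOpNorm S ≤ ENNReal.ofReal R := by
  refine iSup₂_le fun ξ hξ => ?_
  rw [← ofReal_norm]
  exact ENNReal.ofReal_le_ofReal ((h ξ).trans (mul_le_of_le_one_right hR hξ))

end UnboundedOpNorm

namespace StarFiltration

variable {A : Type*} [Ring A] [StarRing A] [Algebra ℂ A] [StarModule ℂ A]
  (F : StarFiltration A) (σ : FaithfulState A)

/-! ### The unbounded operator `D` -/

theorem mem_dirac_domain_iff {ξ : σ.L2} :
    ξ ∈ (F.dirac σ).domain ↔ Summable fun n : ℕ => ‖(n : ℂ) • F.projP σ n ξ‖ ^ 2 := by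
  have h := F.summable_projP_iff σ fun n => (n : ℂ) • ξ
  simp only [map_smul] at h
  exact h

theorem projP_dirac (ξ : (F.dirac σ).domain) (m : ℕ) :
    F.projP σ m (F.dirac σ ξ) = (m : ℂ) • F.projP σ m (ξ : σ.L2) := by
  have h1 : HasSum (fun n : ℕ => (n : ℂ) • F.projP σ n (ξ : σ.L2)) (F.dirac σ ξ) :=
    Summable.hasSum ξ.2
  refine ((F.projP σ m).hasSum h1).unique ?_
  convert hasSum_single (f := fun n : ℕ => F.projP σ m ((n : ℂ) • F.projP σ n (ξ : σ.L2))) m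
    fun n hn => ?_ using 1
  · simp [projP_projP]
  · simp [projP_projP, hn.symm]

theorem mem_dirac_domain_of_mem_vecSpace {n : ℕ} {ξ : σ.L2} (hξ : ξ ∈ F.vecSpace σ n) :
    ξ ∈ (F.dirac σ).domain := by
  rw [mem_dirac_domain_iff]
  refine summable_of_ne_finset_zero (s := Finset.range (n + 1)) fun m hm => ?_
  rw [F.projP_eq_zero σ (by simpa using hm) hξ]
  simp

theorem vec_mem_dirac_domain (a : A) : σ.vec a ∈ (F.dirac σ).domain :=
  have ⟨_, hn⟩ := F.exists_mem a
  F.mem_dirac_domain_of_mem_vecSpace σ (F.vec_mem_vecSpace σ hn)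

theorem dirac_projP (n : ℕ) (x : σ.L2) (h : F.projP σ n x ∈ (F.dirac σ).domain) :
    F.dirac σ ⟨F.projP σ n x, h⟩ = (n : ℂ) • F.projP σ n x := by
  refine F.ext_projP σ fun m => ?_
  rw [projP_dirac, map_smul, projP_projP]
  split_ifs with hmn
  · rw [hmn]
  · simp

/-! ### The matrix entries of elements of `A` and of their commutators with `D` -/

variable {σ} (hσ : σ.LeftRegularBounded)

theorem leftRep_mem_vecSpace {k n : ℕ} {a : A} (ha : a ∈ F.space k) {x : σ.L2}
    (hx : x ∈ F.vecSpace σ n) : FaithfulState.leftRep hσ a x ∈ F.vecSpace σ (k + n) := by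
  obtain ⟨b, hb, rfl⟩ := hx
  rw [FaithfulState.leftRep_vec]
  exact F.vec_mem_vecSpace σ (F.mul_mem k n a ha b hb)

/-- `A_k` acts by matrices of band width `k`. Below the diagonal this is `A_k A_n ⊆ A_{k+n}`;
above the diagonal it follows by passing to the adjoint. -/
theorem projP_leftRep_projP_eq_zero {k m n : ℕ} {a : A} (ha : a ∈ F.space k)
    (h : k + n < m ∨ k + m < n) (x : σ.L2) :
    F.projP σ m (FaithfulState.leftRep hσ a (F.projP σ n x)) = 0 := by
  rcases h with h | h
  · exact F.projP_eq_zero σ h (F.leftRep_mem_vecSpace hσ ha (F.projP_mem σ n x))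
  · refine ext_inner_left ℂ fun y => ?_
    rw [← inner_projP, inner_zero_right]
    obtain ⟨b, -, hb⟩ := F.projP_mem σ n x
    obtain ⟨c, hc, hc'⟩ := F.projP_mem σ m y
    change σ.vec b = _ at hb
    change σ.vec c = _ at hc'
    rw [← hb, ← hc', FaithfulState.leftRep_vec, FaithfulState.inner_vec]
    have h1 : star c * (a * b) = star (star a * c) * b := by simp [mul_assoc]
    rw [h1, ← FaithfulState.inner_vec, hb, ← inner_projP,
      F.projP_eq_zero σ h (F.vec_mem_vecSpace σ (F.mul_mem k m _ (F.star_mem k a ha) c hc)),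
      inner_zero_left]

theorem leftRep_add (a b : A) : FaithfulState.leftRep hσ (a + b) =
    FaithfulState.leftRep hσ a + FaithfulState.leftRep hσ b :=
  DFunLike.coe_injective <| (denseRange_vec σ).equalizer (ContinuousLinearMap.continuous _)
    (ContinuousLinearMap.continuous _) <| funext fun c => by
      simp [FaithfulState.leftRep_vec, add_mul]

theorem leftRep_smul (c : ℂ) (a : A) : FaithfulState.leftRep hσ (c • a) =
    c • FaithfulState.leftRep hσ a :=
  DFunLike.coe_injective <| (denseRange_vec σ).equalizer (ContinuousLinearMap.continuous _)
    (ContinuousLinearMap.continuous _) <| funext fun b => by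
      simp only [Function.comp_apply, _root_.smul_apply, FaithfulState.leftRep_vec,
        smul_mul_assoc, map_smul]

theorem leftRep_one : FaithfulState.leftRep hσ 1 = ContinuousLinearMap.id ℂ σ.L2 :=
  DFunLike.coe_injective <| (denseRange_vec σ).equalizer (ContinuousLinearMap.continuous _)
    (ContinuousLinearMap.continuous _) <| funext fun c => by
      simp [FaithfulState.leftRep_vec]

theorem projP_leftRep_eq_sum {k : ℕ} {a : A} (ha : a ∈ F.space k) (m : ℕ) (x : σ.L2) :
    F.projP σ m (FaithfulState.leftRep hσ a x) = ∑ n ∈ Finset.range (k + m + 1),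
      F.projP σ m (FaithfulState.leftRep hσ a (F.projP σ n x)) := by
  have h1 : Tendsto (fun N => F.projP σ m (FaithfulState.leftRep hσ a (F.projQ σ N x))) atTop
      (𝓝 (F.projP σ m (FaithfulState.leftRep hσ a x))) :=
    (((F.projP σ m).comp (FaithfulState.leftRep hσ a)).continuous.tendsto x).comp
      (F.tendsto_projQ σ x)
  refine tendsto_nhds_unique h1 (tendsto_const_nhds.congr' ?_)
  filter_upwards [eventually_ge_atTop (k + m)] with N hN
  rw [← sum_projP, map_sum, map_sum]
  refine Finset.sum_subset (Finset.range_subset_range.2 (by lia)) fun n _ hn => ?_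
  exact F.projP_leftRep_projP_eq_zero hσ ha (Or.inr (by simpa using hn)) x

/-- The components of `[D, a] ξ` for `ξ` in the domain of `D`. For `a ∈ A_k` the sum has finitely
many nonzero terms, so that it makes sense without assuming that `a ξ` is in the domain of `D`. -/
theorem smul_projP_leftRep {k : ℕ} {a : A} (ha : a ∈ F.space k) (m : ℕ)
    (ξ : (F.dirac σ).domain) :
    (m : ℂ) • F.projP σ m (FaithfulState.leftRep hσ a (ξ : σ.L2)) -
        F.projP σ m (FaithfulState.leftRep hσ a (F.dirac σ ξ)) =
      ∑ n ∈ Finset.range (k + m + 1), ((m : ℂ) - n) •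
        F.projP σ m (FaithfulState.leftRep hσ a (F.projP σ n (ξ : σ.L2))) := by
  rw [F.projP_leftRep_eq_sum hσ ha, F.projP_leftRep_eq_sum hσ ha m (F.dirac σ ξ),
    Finset.smul_sum, ← Finset.sum_sub_distrib]
  refine Finset.sum_congr rfl fun n _ => ?_
  rw [projP_dirac, map_smul, map_smul, sub_smul]

theorem card_band_le (s : Finset ℕ) (N m : ℕ) :
    ((s.filter fun n => m ≤ n + N ∧ n ≤ m + N).card : ℝ) ≤ 2 * N + 1 := by
  have h : s.filter (fun n => m ≤ n + N ∧ n ≤ m + N) ⊆ Finset.Icc (m - N) (m + N) := fun n hn => by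
    simp only [Finset.mem_filter, Finset.mem_Icc] at hn ⊢
    lia
  have := Finset.card_le_card h
  rw [Nat.card_Icc] at this
  exact_mod_cast this.trans (by lia)

/-- The commutator of `D` with an element of `A_k` is bounded, because its matrix has band width
`k` and the factors `m - n` are bounded on the band. -/
theorem sum_norm_sq_commutator_le {k : ℕ} {a : A} (ha : a ∈ F.space k)
    (ξ : (F.dirac σ).domain) (M : ℕ) :
    ∑ m ∈ Finset.range (M + 1), ‖(m : ℂ) • F.projP σ m (FaithfulState.leftRep hσ a (ξ : σ.L2)) -
        F.projP σ m (FaithfulState.leftRep hσ a (F.dirac σ ξ))‖ ^ 2 ≤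
      (2 * k + 1) * k ^ 2 * (‖FaithfulState.leftRep hσ a‖ * ‖(ξ : σ.L2)‖) ^ 2 := by
  set T := FaithfulState.leftRep hσ a
  let φ : ℕ → ℕ → ℝ := fun m n => if m ≤ n + k ∧ n ≤ m + k then k else 0
  have hφ : ∀ m, ∑ n ∈ Finset.range (k + M + 1), φ m n ^ 2 ≤ (2 * k + 1) * (k : ℝ) ^ 2 := by
    intro m
    have : ∀ n, φ m n ^ 2 = if m ≤ n + k ∧ n ≤ m + k then (k : ℝ) ^ 2 else 0 := fun n => by
      simp only [φ]; split_ifs <;> simp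
    simp_rw [this]
    rw [← Finset.sum_filter, Finset.sum_const, nsmul_eq_mul]
    gcongr
    exact card_band_le _ k m
  have hentry : ∀ m n : ℕ, ‖((m : ℂ) - n) • F.projP σ m (T (F.projP σ n (ξ : σ.L2)))‖ ≤
      φ m n * ‖F.projP σ m (T (F.projP σ n (ξ : σ.L2)))‖ := by
    intro m n
    by_cases h : m ≤ n + k ∧ n ≤ m + k
    · rw [norm_smul]
      gcongr
      simp only [φ, if_pos h]
      have : ((m : ℂ) - n) = ((m - n : ℝ) : ℂ) := by push_cast; rfl
      rw [this, Complex.norm_real, Real.norm_eq_abs, abs_le]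
      have h1 : (m : ℝ) ≤ n + k := by exact_mod_cast h.1
      have h2 : (n : ℝ) ≤ m + k := by exact_mod_cast h.2
      constructor <;> linarith
    · rw [F.projP_leftRep_projP_eq_zero hσ ha (by lia)]
      simp
  calc _ ≤ ∑ m ∈ Finset.range (M + 1), (∑ n ∈ Finset.range (k + M + 1),
          φ m n * ‖F.projP σ m (T (F.projP σ n (ξ : σ.L2)))‖) ^ 2 := by
        refine Finset.sum_le_sum fun m hm => ?_
        rw [F.smul_projP_leftRep hσ ha]
        gcongr
        refine (norm_sum_le _ _).trans ((Finset.sum_le_sum fun n _ => hentry m n).trans ?_)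
        refine Finset.sum_le_sum_of_subset_of_nonneg (Finset.range_subset_range.2 ?_)
          fun n _ _ => (norm_nonneg _).trans (hentry m n)
        have := Finset.mem_range.1 hm
        lia
    _ ≤ (2 * k + 1) * k ^ 2 * ∑ n ∈ Finset.range (k + M + 1), ‖T (F.projP σ n (ξ : σ.L2))‖ ^ 2 :=
        F.sum_sq_schur_le σ _ _ hφ _
    _ ≤ (2 * k + 1) * k ^ 2 *
          ∑ n ∈ Finset.range (k + M + 1), ‖T‖ ^ 2 * ‖F.projP σ n (ξ : σ.L2)‖ ^ 2 := by
        gcongr with n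
        rw [← mul_pow]
        gcongr
        exact T.le_opNorm _
    _ ≤ _ := by
        rw [← Finset.mul_sum, mul_pow]
        gcongr
        exact F.sum_norm_sq_projP_le σ _ _

theorem leftRep_mem_dirac_domain (a : A) {ξ : σ.L2} (hξ : ξ ∈ (F.dirac σ).domain) :
    FaithfulState.leftRep hσ a ξ ∈ (F.dirac σ).domain := by
  obtain ⟨k, ha⟩ := F.exists_mem a
  rw [mem_dirac_domain_iff]
  refine summable_of_sum_range_le
    (c := 2 * ((2 * k + 1) * k ^ 2 * (‖FaithfulState.leftRep hσ a‖ * ‖ξ‖) ^ 2) +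
      2 * ‖FaithfulState.leftRep hσ a (F.dirac σ ⟨ξ, hξ⟩)‖ ^ 2)
    (fun n => by positivity) fun M => ?_
  have h1 := F.sum_norm_sq_commutator_le hσ ha ⟨ξ, hξ⟩ M
  have h2 := F.sum_norm_sq_projP_le σ (Finset.range (M + 1))
    (FaithfulState.leftRep hσ a (F.dirac σ ⟨ξ, hξ⟩))
  refine le_trans ?_ (add_le_add (mul_le_mul_of_nonneg_left h1 zero_le_two)
    (mul_le_mul_of_nonneg_left h2 zero_le_two))
  rw [Finset.mul_sum, Finset.mul_sum, ← Finset.sum_add_distrib]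
  refine (Finset.sum_le_sum_of_subset_of_nonneg (Finset.range_subset_range.2 M.le_succ)
    fun _ _ _ => by positivity).trans (Finset.sum_le_sum fun m _ => ?_)
  set x := (m : ℂ) • F.projP σ m (FaithfulState.leftRep hσ a ξ)
  set y := F.projP σ m (FaithfulState.leftRep hσ a (F.dirac σ ⟨ξ, hξ⟩))
  have h3 : ‖x‖ ≤ ‖x - y‖ + ‖y‖ := by simpa using norm_add_le (x - y) y
  nlinarith [sq_nonneg (‖x - y‖ - ‖y‖), norm_nonneg x, norm_nonneg y, norm_nonneg (x - y)]

/-- The commutator `[D, a]`; its domain is that of `D`. -/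
noncomputable abbrev commutator (a : A) : σ.L2 →ₗ.[ℂ] σ.L2 :=
  unboundedCommutator (F.dirac σ) (FaithfulState.leftRep hσ a)

theorem mem_commutator_domain (a : A) {ξ : σ.L2} :
    ξ ∈ (F.commutator hσ a).domain ↔ ξ ∈ (F.dirac σ).domain :=
  ⟨fun h => h.1, fun h => ⟨h, F.leftRep_mem_dirac_domain hσ a h⟩⟩

theorem projP_commutator (a : A) {x : σ.L2} (hx : x ∈ (F.dirac σ).domain) (m : ℕ) :
    F.projP σ m (F.commutator hσ a ⟨x, (F.mem_commutator_domain hσ a).2 hx⟩) =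
      (m : ℂ) • F.projP σ m (FaithfulState.leftRep hσ a x) -
        F.projP σ m (FaithfulState.leftRep hσ a (F.dirac σ ⟨x, hx⟩)) := by
  change F.projP σ m (F.dirac σ ⟨FaithfulState.leftRep hσ a x, _⟩ -
    FaithfulState.leftRep hσ a (F.dirac σ ⟨x, hx⟩)) = _
  rw [map_sub, projP_dirac]

theorem projP_mem_dirac_domain (n : ℕ) (x : σ.L2) : F.projP σ n x ∈ (F.dirac σ).domain :=
  F.mem_dirac_domain_of_mem_vecSpace σ (F.projP_mem σ n x)

theorem projP_commutator_projP (a : A) (m n : ℕ) (x : σ.L2) :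
    F.projP σ m (F.commutator hσ a
        ⟨_, (F.mem_commutator_domain hσ a).2 (F.projP_mem_dirac_domain n x)⟩) =
      ((m : ℂ) - n) • F.projP σ m (FaithfulState.leftRep hσ a (F.projP σ n x)) := by
  rw [F.projP_commutator hσ a (F.projP_mem_dirac_domain n x) m, dirac_projP, map_smul, map_smul,
    sub_smul]

/-! ### `L` is a finite seminorm -/

theorem lip_le (a : A) {R : ℝ} (hR : 0 ≤ R) (h : ∀ x (hx : x ∈ (F.dirac σ).domain),
    ‖F.commutator hσ a ⟨x, (F.mem_commutator_domain hσ a).2 hx⟩‖ ≤ R * ‖x‖) :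
    F.lip hσ a ≤ ENNReal.ofReal R :=
  unboundedOpNorm_le (F.commutator hσ a) hR fun ξ =>
    h ξ ((F.mem_commutator_domain hσ a).1 ξ.2)

theorem lip_ne_top (a : A) : F.lip hσ a ≠ ∞ := by
  obtain ⟨k, ha⟩ := F.exists_mem a
  refine ne_top_of_le_ne_top ENNReal.ofReal_ne_top (F.lip_le hσ a
    (R := √((2 * k + 1) * k ^ 2) * ‖FaithfulState.leftRep hσ a‖) (by positivity) fun x hx => ?_)
  refine le_of_sq_le_sq ?_ (by positivity)
  refine (F.norm_sq_le_of_sum_le σ (R := (2 * k + 1) * k ^ 2 *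
    (‖FaithfulState.leftRep hσ a‖ * ‖x‖) ^ 2) fun M => ?_).trans_eq ?_
  · simp_rw [F.projP_commutator hσ a hx]
    exact F.sum_norm_sq_commutator_le hσ ha ⟨x, hx⟩ M
  · rw [mul_assoc (√_), mul_pow (√_), Real.sq_sqrt (by positivity)]

theorem norm_commutator_le (a : A) {x : σ.L2} (hx : x ∈ (F.dirac σ).domain) :
    ‖F.commutator hσ a ⟨x, (F.mem_commutator_domain hσ a).2 hx⟩‖ ≤
      (F.lip hσ a).toReal * ‖x‖ :=
  norm_apply_le_unboundedOpNorm _ (F.lip_ne_top hσ a) ⟨x, (F.mem_commutator_domain hσ a).2 hx⟩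

theorem lip_add_le (a b : A) : F.lip hσ (a + b) ≤ F.lip hσ a + F.lip hσ b := by
  rw [← ENNReal.ofReal_toReal (F.lip_ne_top hσ a), ← ENNReal.ofReal_toReal (F.lip_ne_top hσ b),
    ← ENNReal.ofReal_add ENNReal.toReal_nonneg ENNReal.toReal_nonneg]
  refine F.lip_le hσ (a + b) (by positivity) fun x hx => ?_
  have h : F.commutator hσ (a + b) ⟨x, (F.mem_commutator_domain hσ (a + b)).2 hx⟩ =
      F.commutator hσ a ⟨x, (F.mem_commutator_domain hσ a).2 hx⟩ +
        F.commutator hσ b ⟨x, (F.mem_commutator_domain hσ b).2 hx⟩ := by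
    refine F.ext_projP σ fun m => ?_
    rw [map_add, F.projP_commutator hσ _ hx, F.projP_commutator hσ _ hx,
      F.projP_commutator hσ _ hx, leftRep_add]
    simp only [map_add, _root_.add_apply, smul_add]
    abel
  rw [h, add_mul]
  exact (norm_add_le _ _).trans
    (add_le_add (F.norm_commutator_le hσ a hx) (F.norm_commutator_le hσ b hx))

theorem lip_smul_le (c : ℂ) (a : A) : F.lip hσ (c • a) ≤ ‖c‖ₑ * F.lip hσ a := by
  rw [← ENNReal.ofReal_toReal (F.lip_ne_top hσ a), ← ofReal_norm,
    ← ENNReal.ofReal_mul (norm_nonneg c)]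
  refine F.lip_le hσ (c • a) (by positivity) fun x hx => ?_
  have h : F.commutator hσ (c • a) ⟨x, (F.mem_commutator_domain hσ (c • a)).2 hx⟩ =
      c • F.commutator hσ a ⟨x, (F.mem_commutator_domain hσ a).2 hx⟩ := by
    refine F.ext_projP σ fun m => ?_
    rw [map_smul, F.projP_commutator hσ _ hx, F.projP_commutator hσ _ hx, leftRep_smul]
    simp only [map_smul, _root_.smul_apply, smul_sub]
    rw [smul_comm]
  rw [h, norm_smul, mul_assoc]
  gcongr
  exact F.norm_commutator_le hσ a hx

theorem lip_smul (c : ℂ) (a : A) : F.lip hσ (c • a) = ‖c‖ₑ * F.lip hσ a := by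
  refine (F.lip_smul_le hσ c a).antisymm ?_
  rcases eq_or_ne c 0 with rfl | hc
  · simp
  · have h := F.lip_smul_le hσ c⁻¹ (c • a)
    rw [smul_smul, inv_mul_cancel₀ hc, one_smul, enorm_inv hc] at h
    calc ‖c‖ₑ * F.lip hσ a ≤ ‖c‖ₑ * (‖c‖ₑ⁻¹ * F.lip hσ (c • a)) := by gcongr
      _ = F.lip hσ (c • a) := by
        rw [← mul_assoc, ENNReal.mul_inv_cancel (by simpa using hc) (by simp), one_mul]

/-! ### `L` and the components of `a` -/

theorem norm_vec_one : ‖σ.vec 1‖ = 1 := by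
  have h := FaithfulState.inner_vec σ 1 1
  rw [star_one, mul_one, σ.map_one, inner_self_eq_norm_sq_to_K] at h
  have h2 : ‖σ.vec 1‖ ^ 2 = 1 := Complex.ofReal_injective (by simpa using h)
  exact (pow_eq_one_iff_of_nonneg (norm_nonneg _) two_ne_zero).1 h2

theorem vec_one_mem : σ.vec 1 ∈ F.vecSpace σ 0 :=
  F.vec_mem_vecSpace σ (by rw [F.space_zero]; exact Submodule.mem_span_singleton_self 1)

/-- Applying `[D, a]` to the vector `1`, which `D` kills, gives `D a = ∑ k a_k`; so `L` controls
the `ℓ²`-size of the components of `a` with the weights `k`. -/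
theorem sum_sq_mul_norm_sq_projP_le (a : A) (s : Finset ℕ) :
    ∑ k ∈ s, (k : ℝ) ^ 2 * ‖F.projP σ k (σ.vec a)‖ ^ 2 ≤ (F.lip hσ a).toReal ^ 2 := by
  have h1 := F.vec_mem_dirac_domain σ 1
  have h0 : F.dirac σ ⟨σ.vec 1, h1⟩ = 0 := by
    refine F.ext_projP σ fun m => ?_
    rw [projP_dirac, map_zero]
    rcases m.eq_zero_or_pos with rfl | hm
    · simp
    · rw [F.projP_eq_zero σ hm F.vec_one_mem, smul_zero]
  have h := F.norm_commutator_le hσ a h1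
  rw [norm_vec_one, mul_one] at h
  refine le_trans ?_ ((F.sum_norm_sq_projP_le σ s _).trans
    (pow_le_pow_left₀ (norm_nonneg _) h 2))
  refine Finset.sum_le_sum fun k _ => ?_
  rw [F.projP_commutator hσ a h1, h0, map_zero, map_zero, sub_zero, FaithfulState.leftRep_vec,
    mul_one, norm_smul, mul_pow]
  simp

theorem lip_eq_zero_iff (a : A) : F.lip hσ a = 0 ↔ ∃ c : ℂ, a = c • 1 := by
  constructor
  · intro h
    have hk : ∀ k, k ≠ 0 → F.projP σ k (σ.vec a) = 0 := fun k hk => by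
      have := F.sum_sq_mul_norm_sq_projP_le hσ a {k}
      rw [h, Finset.sum_singleton, ← mul_pow] at this
      have h2 : (k : ℝ) * ‖F.projP σ k (σ.vec a)‖ = 0 := by
        have h3 : ((k : ℝ) * ‖F.projP σ k (σ.vec a)‖) ^ 2 = 0 :=
          le_antisymm (by simpa using this) (sq_nonneg _)
        simpa using h3
      simpa [hk] using h2
    have h0 : σ.vec a = F.projP σ 0 (σ.vec a) := F.ext_projP σ fun k => by
      rw [projP_projP]
      split_ifs with h0
      · rw [h0]
      · exact hk k h0
    obtain ⟨b, hb, hab⟩ := F.projP_mem σ 0 (σ.vec a)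
    rw [← h0] at hab
    rw [SetLike.mem_coe, F.space_zero, σ.vec_injective hab, Submodule.mem_span_singleton] at hb
    exact ⟨hb.choose, hb.choose_spec.symm⟩
  · rintro ⟨c, rfl⟩
    have h1 : F.lip hσ 1 = 0 := by
      refine nonpos_iff_eq_zero.1 ((F.lip_le hσ 1 le_rfl fun x hx => ?_).trans_eq
        ENNReal.ofReal_zero)
      have : F.commutator hσ 1 ⟨x, (F.mem_commutator_domain hσ 1).2 hx⟩ = 0 :=
        F.ext_projP σ fun m => by
          rw [F.projP_commutator hσ 1 hx, leftRep_one, map_zero]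
          simp only [ContinuousLinearMap.coe_id', id_eq]
          rw [projP_dirac, sub_self]
      simp [this]
    rw [lip_smul, h1, mul_zero]

end StarFiltration

/-! ### Operator norm estimate -/

theorem sum_inv_sq_le_of_injOn {N : ℕ} (t : Finset ℕ) (f : ℕ → ℕ) (hf : Set.InjOn f t)
    (h : ∀ n ∈ t, N < f n) : ∑ n ∈ t, ((f n : ℝ) ^ 2)⁻¹ ≤ 2 / (N + 1) := by
  obtain ⟨M, hM⟩ := (t.image f).exists_nat_subset_range
  rw [← Finset.sum_image (f := fun j : ℕ => ((j : ℝ) ^ 2)⁻¹) hf]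
  refine (Finset.sum_le_sum_of_subset_of_nonneg (t := Finset.Ioo N M) (fun j hj => ?_)
    fun _ _ _ => by positivity).trans (sum_Ioo_inv_sq_le N M)
  have h1 := Finset.mem_range.1 (hM hj)
  obtain ⟨n, hn, rfl⟩ := Finset.mem_image.1 hj
  exact Finset.mem_Ioo.2 ⟨h n hn, h1⟩

/-- The rows of the matrix `1 / (m - n)`, cut off to `|m - n| > N`, are small in `ℓ²`. -/
theorem sum_off_band_inv_sq_le (s : Finset ℕ) (N m : ℕ) :
    ∑ n ∈ s, (if m ≤ n + N ∧ n ≤ m + N then (0 : ℝ) else |(m : ℝ) - n|⁻¹) ^ 2 ≤ 4 / (N + 1) := by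
  have h1 := sum_inv_sq_le_of_injOn (N := N) (s.filter fun n => m + N < n) (fun n => n - m)
    (fun x hx y hy hxy => by
      simp only [Finset.coe_filter, Set.mem_ofPred_eq] at hx hy hxy
      lia) (fun n hn => by have := (Finset.mem_filter.1 hn).2; lia)
  have h2 := sum_inv_sq_le_of_injOn (N := N) (s.filter fun n => n + N < m) (fun n => m - n)
    (fun x hx y hy hxy => by
      simp only [Finset.coe_filter, Set.mem_ofPred_eq] at hx hy hxy
      lia) (fun n hn => by have := (Finset.mem_filter.1 hn).2; lia)
  have h3 : (4 : ℝ) / (N + 1) = 2 / (N + 1) + 2 / (N + 1) := by ring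
  rw [h3]
  refine le_trans (le_of_eq ?_) (add_le_add h1 h2)
  rw [Finset.sum_filter, Finset.sum_filter, ← Finset.sum_add_distrib]
  refine Finset.sum_congr rfl fun n _ => ?_
  by_cases hn : m + N < n
  · rw [if_neg (by lia), if_pos hn, if_neg (by lia), Nat.cast_sub (by lia), add_zero, inv_pow,
      sq_abs, ← neg_sq, neg_sub]
  · by_cases hm : n + N < m
    · rw [if_neg (by lia), if_neg hn, if_pos hm, Nat.cast_sub (by lia), zero_add, inv_pow, sq_abs]
    · rw [if_pos (by lia), if_neg hn, if_neg hm]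
      simp

namespace StarFiltration

variable {A : Type*} [Ring A] [StarRing A] [Algebra ℂ A] [StarModule ℂ A]
  (F : StarFiltration A) {σ : FaithfulState A} (hσ : σ.LeftRegularBounded)

/-- The part of a matrix in the band `|m - n| ≤ N` is bounded in terms of the norms of its
entries. -/
theorem sum_sq_band_le (κ : ℝ) (N : ℕ) (s t : Finset ℕ) (x : σ.L2) :
    ∑ m ∈ t, (∑ n ∈ s, if m ≤ n + N ∧ n ≤ m + N then κ * ‖F.projP σ n x‖ else 0) ^ 2 ≤
      (2 * N + 1) ^ 2 * κ ^ 2 * ‖x‖ ^ 2 := by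
  calc ∑ m ∈ t, (∑ n ∈ s, if m ≤ n + N ∧ n ≤ m + N then κ * ‖F.projP σ n x‖ else 0) ^ 2
      ≤ ∑ m ∈ t, (2 * N + 1) *
          ∑ n ∈ s, if m ≤ n + N ∧ n ≤ m + N then (κ * ‖F.projP σ n x‖) ^ 2 else 0 := by
        refine Finset.sum_le_sum fun m _ => ?_
        rw [← Finset.sum_filter, ← Finset.sum_filter]
        refine sq_sum_le_card_mul_sum_sq.trans ?_
        gcongr
        exact card_band_le s N m
    _ = (2 * N + 1) * ∑ n ∈ s,
          ((t.filter fun m => n ≤ m + N ∧ m ≤ n + N).card : ℝ) * (κ * ‖F.projP σ n x‖) ^ 2 := by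
        rw [← Finset.mul_sum, Finset.sum_comm]
        congr 1
        refine Finset.sum_congr rfl fun n _ => ?_
        simp_rw [and_comm (b := n ≤ _)]
        rw [← Finset.sum_filter, Finset.sum_const, nsmul_eq_mul]
    _ ≤ (2 * N + 1) * ∑ n ∈ s, (2 * N + 1) * (κ * ‖F.projP σ n x‖) ^ 2 := by
        gcongr with n
        exact card_band_le t N n
    _ = (2 * N + 1) ^ 2 * κ ^ 2 * ∑ n ∈ s, ‖F.projP σ n x‖ ^ 2 := by
        simp_rw [mul_pow, ← Finset.mul_sum]
        ring
    _ ≤ _ := by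
        gcongr
        exact F.sum_norm_sq_projP_le σ s x

/-- Off the band `|m - n| ≤ N`, the entries of `a` are those of `[D, a]` multiplied by
`1 / (m - n)`. -/
theorem sum_sq_off_band_le (a : A) (N : ℕ) (s t : Finset ℕ) (x : σ.L2) :
    ∑ m ∈ t, (∑ n ∈ s, if m ≤ n + N ∧ n ≤ m + N then 0 else
        ‖F.projP σ m (FaithfulState.leftRep hσ a (F.projP σ n x))‖) ^ 2 ≤
      4 / (N + 1) * (F.lip hσ a).toReal ^ 2 * ‖x‖ ^ 2 := by
  let y : ℕ → σ.L2 := fun n => F.commutator hσ a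
    ⟨_, (F.mem_commutator_domain hσ a).2 (F.projP_mem_dirac_domain n x)⟩
  have hentry : ∀ m n : ℕ, (if m ≤ n + N ∧ n ≤ m + N then 0 else
      ‖F.projP σ m (FaithfulState.leftRep hσ a (F.projP σ n x))‖) =
      (if m ≤ n + N ∧ n ≤ m + N then (0 : ℝ) else |(m : ℝ) - n|⁻¹) * ‖F.projP σ m (y n)‖ := by
    intro m n
    split_ifs with h
    · rw [zero_mul]
    · have hmn : (m : ℝ) - n ≠ 0 := by
        rw [sub_ne_zero]
        exact_mod_cast (by lia : m ≠ n)
      have h1 : ((m : ℂ) - n) = ((m - n : ℝ) : ℂ) := by push_cast; rfl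
      rw [F.projP_commutator_projP hσ a m n x, norm_smul, h1, Complex.norm_real,
        Real.norm_eq_abs, inv_mul_cancel_left₀ (abs_ne_zero.2 hmn)]
  simp_rw [hentry]
  refine (F.sum_sq_schur_le σ s t (fun m => sum_off_band_inv_sq_le s N m) y).trans ?_
  rw [mul_assoc]
  gcongr
  calc ∑ n ∈ s, ‖y n‖ ^ 2 ≤ ∑ n ∈ s, (F.lip hσ a).toReal ^ 2 * ‖F.projP σ n x‖ ^ 2 := by
        gcongr with n
        rw [← mul_pow]
        gcongr
        exact F.norm_commutator_le hσ a (F.projP_mem_dirac_domain n x)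
    _ ≤ _ := by
        rw [← Finset.mul_sum]
        gcongr
        exact F.sum_norm_sq_projP_le σ s x

/-- The operator norm of `a` is controlled by `L a` and a bound `κ` for the matrix entries of `a`,
with an arbitrarily small factor in front of `L a`. -/
theorem norm_leftRep_sq_le (a : A) (N : ℕ) {κ : ℝ}
    (h : ∀ m n x, ‖F.projP σ m (FaithfulState.leftRep hσ a (F.projP σ n x))‖ ≤
      κ * ‖F.projP σ n x‖) :
    ‖FaithfulState.leftRep hσ a‖ ^ 2 ≤
      8 / (N + 1) * (F.lip hσ a).toReal ^ 2 + 2 * (2 * N + 1) ^ 2 * κ ^ 2 := by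
  set T := FaithfulState.leftRep hσ a
  set R := 8 / (N + 1) * (F.lip hσ a).toReal ^ 2 + 2 * (2 * N + 1) ^ 2 * κ ^ 2
  have hR : 0 ≤ R := by positivity
  have hQ : ∀ M x, ‖T (F.projQ σ M x)‖ ^ 2 ≤ R * ‖x‖ ^ 2 := by
    intro M x
    refine F.norm_sq_le_of_sum_le σ fun K => ?_
    have h1 := F.sum_sq_off_band_le hσ a N (Finset.range (M + 1)) (Finset.range (K + 1)) x
    have h2 := F.sum_sq_band_le κ N (Finset.range (M + 1)) (Finset.range (K + 1)) x
    have h3 : R * ‖x‖ ^ 2 = 2 * (4 / (N + 1) * (F.lip hσ a).toReal ^ 2 * ‖x‖ ^ 2) +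
        2 * ((2 * N + 1) ^ 2 * κ ^ 2 * ‖x‖ ^ 2) := by ring
    rw [h3]
    refine le_trans ?_ (add_le_add (mul_le_mul_of_nonneg_left h1 zero_le_two)
      (mul_le_mul_of_nonneg_left h2 zero_le_two))
    rw [Finset.mul_sum, Finset.mul_sum, ← Finset.sum_add_distrib]
    refine Finset.sum_le_sum fun m _ => ?_
    set u := ∑ n ∈ Finset.range (M + 1), if m ≤ n + N ∧ n ≤ m + N then 0 else
      ‖F.projP σ m (T (F.projP σ n x))‖
    set v := ∑ n ∈ Finset.range (M + 1),
      if m ≤ n + N ∧ n ≤ m + N then κ * ‖F.projP σ n x‖ else 0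
    have h4 : ‖F.projP σ m (T (F.projQ σ M x))‖ ≤ u + v := by
      rw [← sum_projP, map_sum, map_sum, ← Finset.sum_add_distrib]
      refine (norm_sum_le _ _).trans (Finset.sum_le_sum fun n _ => ?_)
      split_ifs
      · rw [zero_add]
        exact h m n x
      · rw [add_zero]
    refine (pow_le_pow_left₀ (norm_nonneg _) h4 2).trans ?_
    linarith [add_sq_le (a := u) (b := v)]
  have hT : ‖T‖ ≤ √R := by
    refine T.opNorm_le_bound (Real.sqrt_nonneg _) fun x => le_of_sq_le_sq ?_ (by positivity)
    rw [mul_pow, Real.sq_sqrt hR]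
    exact le_of_tendsto' (((T.continuous.tendsto x).comp (F.tendsto_projQ σ x)).norm.pow 2)
      fun M => hQ M x
  exact (pow_le_pow_left₀ (norm_nonneg _) hT 2).trans_eq (Real.sq_sqrt hR)

theorem sum_component {K : ℕ} {a : A} (ha : a ∈ F.space K) :
    ∑ k ∈ Finset.range (K + 1), F.component σ k a = a := by
  refine σ.vec_injective ?_
  rw [map_sum]
  simp_rw [vec_component]
  rw [sum_projP, F.projQ_eq_self σ (F.vec_mem_vecSpace σ ha)]

/-- The Haagerup-type condition bounds the matrix entries of `a` by the `ℓ¹`-size of its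
components. -/
theorem norm_entry_le {C : ℝ} (hC : ∀ (a : A) (m n k : ℕ),
    ‖F.projP σ m ∘L FaithfulState.leftRep hσ (F.component σ k a) ∘L F.projP σ n‖
      ≤ C * ‖σ.vec (F.component σ k a)‖) {K : ℕ} {a : A} (ha : a ∈ F.space K) (m n : ℕ)
    (x : σ.L2) : ‖F.projP σ m (FaithfulState.leftRep hσ a (F.projP σ n x))‖ ≤
      (∑ k ∈ Finset.range (K + 1), C * ‖F.projP σ k (σ.vec a)‖) * ‖F.projP σ n x‖ := by
  have h1 : FaithfulState.leftRep hσ a =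
      ∑ k ∈ Finset.range (K + 1), FaithfulState.leftRep hσ (F.component σ k a) := by
    conv_lhs => rw [← F.sum_component (σ := σ) ha]
    exact map_sum (AddMonoidHom.mk' _ (leftRep_add hσ)) _ _
  rw [h1, _root_.sum_apply, map_sum, Finset.sum_mul]
  refine (norm_sum_le _ _).trans (Finset.sum_le_sum fun k _ => ?_)
  have h2 := (F.projP σ m ∘L FaithfulState.leftRep hσ (F.component σ k a) ∘L
    F.projP σ n).le_of_opNorm_le (hC a m n k) (F.projP σ n x)
  rw [vec_component] at h2
  simpa [projP_projP] using h2

theorem sum_norm_projP_le (a : A) (K M : ℕ) :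
    ∑ k ∈ Finset.range (M + 1), ‖F.projP σ k (σ.vec a)‖ ≤
      (K + 1) * ‖F.projQ σ K (σ.vec a)‖ + √(2 / (K + 1)) * (F.lip hσ a).toReal := by
  have h1 : ∑ k ∈ Finset.range (K + 1), ‖F.projP σ k (σ.vec a)‖ ≤
      (K + 1) * ‖F.projQ σ K (σ.vec a)‖ := by
    refine (Finset.sum_le_card_nsmul _ _ ‖F.projQ σ K (σ.vec a)‖ fun k hk => ?_).trans_eq ?_
    · have h := F.norm_projP_le σ k (F.projQ σ K (σ.vec a))
      rwa [projP_projQ, if_pos (by simpa [Nat.lt_succ_iff] using hk)] at h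
    · simp
  have h2 : ∑ k ∈ Finset.Ioo K (M + 1), ‖F.projP σ k (σ.vec a)‖ ≤
      √(2 / (K + 1)) * (F.lip hσ a).toReal := by
    refine le_of_sq_le_sq ?_ (by positivity)
    rw [mul_pow, Real.sq_sqrt (by positivity)]
    have h3 : ∀ k ∈ Finset.Ioo K (M + 1), ‖F.projP σ k (σ.vec a)‖ =
        (k : ℝ)⁻¹ * (k * ‖F.projP σ k (σ.vec a)‖) := fun k hk => by
      rw [inv_mul_cancel_left₀]
      have := (Finset.mem_Ioo.1 hk).1
      exact_mod_cast (by lia : k ≠ 0)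
    rw [Finset.sum_congr rfl h3]
    refine (Finset.sum_mul_sq_le_sq_mul_sq _ _ _).trans ?_
    simp_rw [inv_pow, mul_pow]
    gcongr
    · exact sum_Ioo_inv_sq_le K (M + 1)
    · exact F.sum_sq_mul_norm_sq_projP_le hσ a _
  refine le_trans ?_ (add_le_add h1 h2)
  rw [← Finset.sum_union]
  · refine Finset.sum_le_sum_of_subset_of_nonneg (fun k hk => ?_) fun _ _ _ => norm_nonneg _
    simp only [Finset.mem_union, Finset.mem_range, Finset.mem_Ioo] at hk ⊢
    lia
  · rw [Finset.disjoint_left]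
    intro k hk hk'
    simp only [Finset.mem_range, Finset.mem_Ioo] at hk hk'
    lia

/-! ### Total boundedness of the unit ball of `L` -/

/-- On a ball for `L`, the operator norm is small where finitely many components are small. -/
theorem exists_norm_leftRep_le (hH : F.HaagerupType hσ) {ε : ℝ} (hε : 0 < ε) :
    ∃ K : ℕ, ∃ δ > 0, ∀ a : A, (F.lip hσ a).toReal ≤ 2 → ‖F.projQ σ K (σ.vec a)‖ ≤ δ →
      ‖FaithfulState.leftRep hσ a‖ ≤ ε := by
  obtain ⟨C, hC⟩ := hH
  obtain ⟨N, hN⟩ := exists_nat_gt (64 / ε ^ 2)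
  obtain ⟨κ, hκ0, hκ⟩ : ∃ κ : ℝ, 0 < κ ∧ 2 * (2 * N + 1) ^ 2 * κ ^ 2 = ε ^ 2 / 2 :=
    ⟨ε / (2 * (2 * N + 1)), by positivity, by field_simp⟩
  set c := |C| + 1
  have hc : 0 < c := by positivity
  obtain ⟨K, hK⟩ := exists_nat_gt (2 / (κ / (4 * c)) ^ 2)
  have hK' : √(2 / (K + 1)) ≤ κ / (4 * c) := by
    refine (Real.sqrt_le_left (by positivity)).2 ?_
    rw [div_le_iff₀ (by positivity), mul_comm, ← div_le_iff₀ (by positivity)]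
    linarith
  refine ⟨K, κ / (2 * c * (K + 1)), by positivity, fun a ha hQ => ?_⟩
  obtain ⟨M, hM⟩ := F.exists_mem a
  have h1 : ∑ k ∈ Finset.range (M + 1), C * ‖F.projP σ k (σ.vec a)‖ ≤ κ := by
    have h2 := F.sum_norm_projP_le hσ a K M
    have h3 : ((K : ℝ) + 1) * ‖F.projQ σ K (σ.vec a)‖ ≤ κ / (2 * c) := by
      calc ((K : ℝ) + 1) * ‖F.projQ σ K (σ.vec a)‖ ≤ (K + 1) * (κ / (2 * c * (K + 1))) := by gcongr
        _ = κ / (2 * c) := by field_simp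
    have h4 : √(2 / (K + 1)) * (F.lip hσ a).toReal ≤ κ / (2 * c) := by
      calc √(2 / (K + 1)) * (F.lip hσ a).toReal ≤ κ / (4 * c) * 2 := by gcongr
        _ = κ / (2 * c) := by field_simp; norm_num
    calc ∑ k ∈ Finset.range (M + 1), C * ‖F.projP σ k (σ.vec a)‖
        = C * ∑ k ∈ Finset.range (M + 1), ‖F.projP σ k (σ.vec a)‖ := by rw [Finset.mul_sum]
      _ ≤ c * ∑ k ∈ Finset.range (M + 1), ‖F.projP σ k (σ.vec a)‖ := by
        gcongr
        exact (le_abs_self C).trans (by simp [c])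
      _ ≤ c * (κ / (2 * c) + κ / (2 * c)) := by gcongr; linarith
      _ = κ := by field_simp; norm_num
  have h5 := F.norm_leftRep_sq_le hσ a N (κ := κ) fun m n x =>
    (F.norm_entry_le hσ hC hM m n x).trans (by gcongr)
  rw [hκ] at h5
  refine le_of_sq_le_sq (h5.trans ?_) hε.le
  have h6 : 8 / ((N : ℝ) + 1) * (F.lip hσ a).toReal ^ 2 ≤ 8 / (N + 1) * 2 ^ 2 := by
    gcongr
  have h7 : 8 / ((N : ℝ) + 1) * 2 ^ 2 ≤ ε ^ 2 / 2 := by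
    rw [div_mul_eq_mul_div, div_le_iff₀ (by positivity)]
    rw [div_lt_iff₀ (by positivity)] at hN
    nlinarith [sq_nonneg ε]
  linarith

theorem projP_zero_vec_eq_zero {a : A} (ha : σ.toFun a = 0) : F.projP σ 0 (σ.vec a) = 0 := by
  have h : ⟪F.projP σ 0 (σ.vec a), F.projP σ 0 (σ.vec a)⟫_ℂ = 0 := by
    obtain ⟨b, hb, hb'⟩ := F.projP_mem σ 0 (σ.vec a)
    rw [SetLike.mem_coe, F.space_zero, Submodule.mem_span_singleton] at hb
    obtain ⟨c, rfl⟩ := hb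
    rw [inner_projP, projP_projP, if_pos rfl, ← inner_projP, ← hb']
    change ⟪σ.vec (c • 1), _⟫_ℂ = 0
    rw [map_smul, inner_smul_left, FaithfulState.inner_vec, star_one, one_mul, ha, mul_zero]
  exact inner_self_eq_zero.1 h

theorem norm_projQ_vec_le {a : A} (ha : σ.toFun a = 0) (K : ℕ) :
    ‖F.projQ σ K (σ.vec a)‖ ≤ (F.lip hσ a).toReal := by
  refine le_of_sq_le_sq ?_ ENNReal.toReal_nonneg
  rw [norm_sq_projQ]
  refine le_trans (Finset.sum_le_sum fun k _ => ?_)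
    (F.sum_sq_mul_norm_sq_projP_le hσ a (Finset.range (K + 1)))
  rcases k.eq_zero_or_pos with rfl | hk
  · rw [F.projP_zero_vec_eq_zero ha]
    simp
  · have : (1 : ℝ) ≤ k := by exact_mod_cast hk
    exact le_mul_of_one_le_left (by positivity) (one_le_pow₀ this)

theorem lip_toReal_sub_le (a b : A) :
    (F.lip hσ (a - b)).toReal ≤ (F.lip hσ a).toReal + (F.lip hσ b).toReal := by
  rw [← ENNReal.toReal_add (F.lip_ne_top hσ a) (F.lip_ne_top hσ b)]
  refine ENNReal.toReal_mono
    (ENNReal.add_ne_top.2 ⟨F.lip_ne_top hσ a, F.lip_ne_top hσ b⟩) ?_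
  have h : a - b = a + (-1 : ℂ) • b := by simp [sub_eq_add_neg]
  rw [h]
  refine (F.lip_add_le hσ _ _).trans_eq ?_
  rw [lip_smul]
  simp

/-- The unit ball of `L` is totally bounded for the operator norm modulo the scalars. -/
theorem exists_finite_net (hH : F.HaagerupType hσ) {ε : ℝ} (hε : 0 < ε) :
    ∃ t : Set A, t.Finite ∧ ∀ a, F.lip hσ a ≤ 1 →
      ∃ b ∈ t, ‖FaithfulState.leftRep hσ (a - σ.toFun a • 1 - b)‖ ≤ ε := by
  obtain ⟨K, δ, hδ, h⟩ := F.exists_norm_leftRep_le hσ hH hε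
  set B : Set A := {a | F.lip hσ a ≤ 1 ∧ σ.toFun a = 0}
  have hB : ∀ a ∈ B, (F.lip hσ a).toReal ≤ 1 := fun a ha => by
    simpa using ENNReal.toReal_mono ENNReal.one_ne_top ha.1
  let f : A → F.vecSpace σ K := fun a => ⟨F.projQ σ K (σ.vec a), F.projQ_mem σ K _⟩
  have : ProperSpace (F.vecSpace σ K) := FiniteDimensional.proper ℂ _
  have hf : TotallyBounded (f '' B) := by
    refine (isCompact_closedBall (0 : F.vecSpace σ K) 1).totallyBounded.subset ?_
    rintro _ ⟨a, ha, rfl⟩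
    rw [mem_closedBall_zero_iff]
    exact (F.norm_projQ_vec_le hσ ha.2 K).trans (hB a ha)
  obtain ⟨t, htB, ht, hcov⟩ := Set.exists_subset_image_finite_and.1
    (totallyBounded_iff_subset.1 hf _ (Metric.dist_mem_uniformity hδ))
  refine ⟨t, ht, fun a ha => ?_⟩
  have ha' : a - σ.toFun a • 1 ∈ B := by
    refine ⟨?_, by simp [σ.map_one]⟩
    have h1 := F.lip_add_le hσ a ((-σ.toFun a) • 1)
    rw [(F.lip_eq_zero_iff hσ _).2 ⟨_, rfl⟩, add_zero, neg_smul, ← sub_eq_add_neg] at h1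
    exact h1.trans ha
  obtain ⟨_, ⟨b, hb, rfl⟩, hab⟩ := Set.mem_iUnion₂.1 (hcov ⟨_, ha', rfl⟩)
  refine ⟨b, hb, h _ ?_ ?_⟩
  · linarith [F.lip_toReal_sub_le hσ (a - σ.toFun a • 1) b, hB _ ha', hB _ (htB hb)]
  · rw [map_sub σ.vec, map_sub, ← dist_eq_norm]
    exact hab.le

/-! ### The topology of the state space -/

theorem lipMetric_le_weakStar :
    (StateSpace.lipMetric (fun a : A => ‖FaithfulState.leftRep hσ a‖)
      (F.lip hσ)).toUniformSpace.toTopologicalSpace ≤ StateSpace.weakStar _ := by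
  let _ := StateSpace.lipMetric (fun a : A => ‖FaithfulState.leftRep hσ a‖) (F.lip hσ)
  refine continuous_iff_le_induced.1 (continuous_pi fun a => ?_)
  -- Adding `1` makes the rescaling factor positive also when `L a = 0`.
  set r : NNReal := (F.lip hσ a).toNNReal + 1
  have hr : (r : ℝ≥0∞) ≠ 0 := by simp [r]
  set z : ℂ := ((r⁻¹ : ℝ) : ℂ)
  have hz : ‖z‖ₑ = (r : ℝ≥0∞)⁻¹ := by
    rw [← ENNReal.coe_inv (by simpa using hr), enorm_eq_nnnorm]
    congr 1
    exact NNReal.eq (by simp [z])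
  have hL : F.lip hσ (z • a) ≤ 1 := by
    rw [lip_smul, hz, ← ENNReal.coe_toNNReal (F.lip_ne_top hσ a)]
    calc (r : ℝ≥0∞)⁻¹ * ((F.lip hσ a).toNNReal : ℝ≥0∞) ≤ (r : ℝ≥0∞)⁻¹ * r := by
          gcongr
          simp [r]
      _ = 1 := ENNReal.inv_mul_cancel hr ENNReal.coe_ne_top
  refine LipschitzWith.continuous (K := r) fun μ ν => ?_
  have h : ‖μ.toFun (z • a) - ν.toFun (z • a)‖ₑ ≤ edist μ ν :=
    le_iSup₂ (f := fun (a : A) (_ : F.lip hσ a ≤ 1) => ‖μ.toFun a - ν.toFun a‖ₑ) _ hL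
  rw [map_smul, map_smul, ← smul_sub, enorm_smul, hz] at h
  rw [edist_eq_enorm_sub]
  calc ‖μ.toFun a - ν.toFun a‖ₑ = r * ((r : ℝ≥0∞)⁻¹ * ‖μ.toFun a - ν.toFun a‖ₑ) := by
        rw [← mul_assoc, ENNReal.mul_inv_cancel hr ENNReal.coe_ne_top, one_mul]
    _ ≤ r * edist μ ν := by gcongr

theorem weakStar_le_lipMetric (hH : F.HaagerupType hσ) :
    StateSpace.weakStar _ ≤ (StateSpace.lipMetric (fun a : A => ‖FaithfulState.leftRep hσ a‖)
      (F.lip hσ)).toUniformSpace.toTopologicalSpace := by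
  refine le_of_nhds_le_nhds fun μ => ?_
  rw [(@Metric.nhds_basis_closedEBall _ (StateSpace.lipMetric
    (fun a : A => ‖FaithfulState.leftRep hσ a‖) (F.lip hσ)) μ).ge_iff]
  intro ε hε
  obtain ⟨η, hη, hηε⟩ := ENNReal.lt_iff_exists_nnreal_btwn.1 hε
  have hη' : (0 : ℝ) < η := by exact_mod_cast hη
  obtain ⟨t, ht, hnet⟩ := F.exists_finite_net hσ hH (ε := η / 3) (by positivity)
  have hev : ∀ᶠ ν in @nhds _ (StateSpace.weakStar (fun a : A => ‖FaithfulState.leftRep hσ a‖)) μ,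
      ∀ b ∈ t, ‖ν.toFun b - μ.toFun b‖ < η / 3 := by
    rw [nhds_induced]
    refine ht.eventually_all.2 fun b _ => ?_
    refine Filter.Eventually.comap (p := fun g : A → ℂ => ‖g b - μ.toFun b‖ < η / 3) ?_ _
    have := (continuous_apply (A := fun _ : A => ℂ) b).tendsto fun a => μ.toFun a
    simpa [dist_eq_norm] using Metric.tendsto_nhds.1 this (η / 3) (by positivity)
  filter_upwards [hev] with ν hν
  refine (iSup₂_le fun a ha => ?_).trans hηε.le
  obtain ⟨b, hb, hab⟩ := hnet a ha
  set c := a - σ.toFun a • 1 - b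
  -- The scalar part of `a` does not contribute, as states agree on scalars.
  have h1 : ν.toFun a - μ.toFun a = ν.toFun c - μ.toFun c + (ν.toFun b - μ.toFun b) := by
    simp only [c, map_sub, map_smul, ν.map_one, μ.map_one]
    ring
  have h2 : ‖ν.toFun a - μ.toFun a‖ ≤ η := by
    rw [h1]
    have := norm_add_le (ν.toFun c - μ.toFun c) (ν.toFun b - μ.toFun b)
    linarith [norm_sub_le (ν.toFun c) (μ.toFun c), ν.norm_le c, μ.norm_le c, hν b hb]
  rw [← ofReal_norm]
  exact (ENNReal.ofReal_le_ofReal h2).trans_eq (ENNReal.ofReal_coe_nnreal)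

end StarFiltration

theorem theorem1p1 {A : Type*} [Ring A] [StarRing A] [Algebra ℂ A] [StarModule ℂ A]
    (F : StarFiltration A) (σ : FaithfulState A) (hσ : σ.LeftRegularBounded)
    (hH : F.HaagerupType hσ) :
    IsLipNorm (fun a : A => ‖FaithfulState.leftRep hσ a‖) (F.lip hσ) where
  ne_top := F.lip_ne_top hσ
  add_le := F.lip_add_le hσ
  smul_eq := F.lip_smul hσ
  eq_zero_iff := F.lip_eq_zero_iff hσ
  topology_eq := le_antisymm (F.lipMetric_le_weakStar hσ) (F.weakStar_le_lipMetric hσ hH)
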